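/- For a permutation $w=w_1\cdots w_n$ of $\{1,\dots,n\}$, an alternating subsequence of $w$ is a subsequence $w_{i_1},\dots,w_{i_k}$ ($i_1<\cdots<i_k$) with $w_{i_1}>w_{i_2}<w_{i_3}>w_{i_4}<\cdots$ (so that, if it has length at least two, it begins with a descent; every subsequence of length $0$ or $1$ is alternating). Let $\mathrm{as}(w)$ be the largest length of an alternating subsequence of $w$. For $n,k\ge 0$ let $a_k(n)$ be the number of permutations $w$ of $\{1,\dots,n\}$ with $\mathrm{as}(w)=k$, and let $T_n(t)=\sum_{k=0}^n a_k(n)t^k\in\mathbb{Z}[t]$. Let $E_n$ be the Euler number, i.e. the number of permutations $w$ of $\{1,\dots,n\}$ with $w_1>w_2<w_3>\cdots w_n$ (for odd $n$, $E_n$ is called a tangent number). Then for every $n\ge 0$ the polynomial $T_n(t)$ is divisible by $(1+t)^{\lfloor n/2\rfloor}$ in $\mathbb{Z}[t]$. Moreover, if $U_n(t)=T_n(t)/(1+t)^{\lfloor n/2\rfloor}$, then for every $n\ge 0$ $$U_{2n}(-1)=-U_{2n+1}(-1)=\frac{(-1)^nE_{2n+1}}{2^n}.$$ In particular, for every $n\ge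 2$ we have $T_n(-1)=0$, that is, $$\#\{w:\mathrm{as}(w)\text{ even}\}=\#\{w:\mathrm{as}(w)\text{ odd}\}=\frac{n!}{2},$$ where $w$ ranges over the permutations of $\{1,\dots,n\}$. -/

import Mathlib

open Polynomial

/-- A finite sequence `s 0, s 1, …` is alternating if `s 0 > s 1 < s 2 > s 3 < ⋯`:
with positions counted from `0`, it descends after each even position and ascends after each
odd one. Sequences of length `0` and `1` are alternating. -/
def IsAlternating {α : Type*} [LT α] {k : ℕ} (s : Fin k → α) : Prop :=
  ∀ i j : Fin k, (i : ℕ) + 1 = j →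
    (Even (i : ℕ) → s j < s i) ∧ (Odd (i : ℕ) → s i < s j)

instance {α : Type*} [LT α] [DecidableLT α] {k : ℕ} (s : Fin k → α) :
    Decidable (IsAlternating s) := by
  unfold IsAlternating
  infer_instance

/-- The lengths of the alternating subsequences `w (p 0), …, w (p (k - 1))`,
`p 0 < ⋯ < p (k - 1)`, of the permutation `w`. -/
def altSubseqLengths {n : ℕ} (w : Equiv.Perm (Fin n)) : Set ℕ :=
  {k | ∃ p : Fin k → Fin n, StrictMono p ∧ IsAlternating (fun i => w (p i))}

/-- `as(w)`: the length of the longest alternating subsequence of `w`. -/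
noncomputable def altLength {n : ℕ} (w : Equiv.Perm (Fin n)) : ℕ :=
  sSup (altSubseqLengths w)

/-- The supremum defining `altLength` is a maximum, so `altLength` has no default value. -/
theorem altLength_isGreatest {n : ℕ} (w : Equiv.Perm (Fin n)) :
    IsGreatest (altSubseqLengths w) (altLength w) := by
  have hb : BddAbove (altSubseqLengths w) := by
    refine ⟨n, ?_⟩
    rintro k ⟨p, hp, -⟩
    simpa using Fintype.card_le_of_injective p hp.injective
  have hne : (altSubseqLengths w).Nonempty :=
    ⟨0, fun i => i.elim0, fun i => i.elim0, fun i => i.elim0⟩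
  exact ⟨Nat.sSup_mem hne hb, fun k hk => le_csSup hb hk⟩

/-- `a_k(n)`: the number of permutations `w` of `n` letters with `as(w) = k`. -/
noncomputable def altCount (k n : ℕ) : ℕ :=
  (Finset.univ.filter fun w : Equiv.Perm (Fin n) => altLength w = k).card

/-- The polynomial `T_n(t) = ∑_{k=0}^n a_k(n) t^k`. -/
noncomputable def altPoly (n : ℕ) : ℤ[X] :=
  ∑ k ∈ Finset.range (n + 1), C (altCount k n : ℤ) * X ^ k

/-- The Euler number `E_n`: the number of alternating permutations `w_1 > w_2 < w_3 > ⋯` of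
`n` letters. For odd `n` it is called a tangent number. -/
def eulerNumber (n : ℕ) : ℕ :=
  (Finset.univ.filter fun w : Equiv.Perm (Fin n) => IsAlternating w).card

/-!
Let `F_n(x, y) = ∑_w x ^ as(w) * y ^ (n - as(w))`. Inserting the letter `n + 1` into `w` leaves
`as(w)` unchanged at `as(w)` positions, raises it by one at a single position, and raises it by two
at the remaining ones. If `D` is the derivation with `D x = x * y` and `D y = x ^ 2` (secant and
tangent), this says `F_{n+1} = D F_n + x * F_n`, and hence `(x + y) * F_n = D^n (x + y)`.

The element `c = x ^ 2 - y ^ 2` is a constant of `D`, and both `y` for `D` and `x + y` for `2 * D`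
satisfy the Riccati equation: the derivative of `z` is `z ^ 2 + c`. The iterated derivatives of a
solution are `∑ l, N(n, l) * z ^ (n + 1 - 2 * l) * c ^ l` with universal coefficients `N(n, l)`, and
`c = (x + y) * (x - y)`, so `2 ^ n * F_n(x, y)` equals
`(x + y) ^ ⌊n / 2⌋ * ∑ l, N(n, l) * (x + y) ^ (⌊(n + 1) / 2⌋ - l) * (x - y) ^ l`. At
`(x, y) = (t, 1)` this gives the divisibility and expresses `U_n(-1)` by `N(n, ⌊(n + 1) / 2⌋)`.

For odd `n` that coefficient is `E_n`: the symmetry `D ↦ -D`, `y ↦ -y` isolates `D^n y` in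
`D^n (x + y)`, and at `(x, y) = (1, 0)` only the permutations with `as(w) = n`, that is, the
alternating ones, contribute to `F_n`.
-/

section AlternatingLists

variable {α : Type*}

/-- The step from `a` to `b` is an ascent if `up = true` and a descent if `up = false`. -/
abbrev IsStep [LT α] (up : Bool) (a b : α) : Prop :=
  if up then a < b else b < a

/-- The list alternates strictly between ascents and descents, and its first step, if it has
one, is an ascent if and only if `up = true`. -/
def AlternatesFrom [LT α] : Bool → List α → Prop
  | up, a :: b :: l => IsStep up a b ∧ AlternatesFrom (!up) (b :: l)
  | _, _ => True

theorem AlternatesFrom.tail [LT α] {up : Bool} {a : α} {s : List α}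
    (h : AlternatesFrom up (a :: s)) : AlternatesFrom (!up) s := by
  cases s with
  | nil => trivial
  | cons b s => exact h.2

theorem alternatesFrom_iff_getElem [LT α] (up : Bool) (l : List α) :
    AlternatesFrom up l ↔
      ∀ (i : ℕ) (h : i + 1 < l.length), IsStep (up == decide (Even i)) l[i] l[i + 1] := by
  induction l generalizing up with
  | nil => simp [AlternatesFrom]
  | cons a l ih =>
    cases l with
    | nil => simp [AlternatesFrom]
    | cons b l =>
      have hdir (i : ℕ) : (up == decide (Even (i + 1))) = ((!up) == decide (Even i)) := by
        cases up <;> simp [Nat.even_add_one, -Nat.not_even_iff_odd]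
      rw [AlternatesFrom, ih (!up)]
      constructor
      · rintro ⟨hab, hl⟩ (_ | i) hi
        · simpa using hab
        · rw [hdir]
          exact hl i (Nat.lt_of_succ_lt_succ hi)
      · refine fun h => ⟨by simpa using h 0 (by simp), fun i hi => ?_⟩
        rw [← hdir]
        exact h (i + 1) (Nat.succ_lt_succ hi)

theorem isAlternating_iff_alternatesFrom [LT α] {k : ℕ} (s : Fin k → α) :
    IsAlternating s ↔ AlternatesFrom false (List.ofFn s) := by
  rw [alternatesFrom_iff_getElem]
  constructor
  · intro h i hi
    rw [List.length_ofFn] at hi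
    have hstep := h ⟨i, by omega⟩ ⟨i + 1, hi⟩ rfl
    by_cases heven : Even i
    · simpa [IsStep, heven] using hstep.1 heven
    · simpa [IsStep, heven] using hstep.2 (Nat.not_even_iff_odd.1 heven)
  · rintro h ⟨i, hi⟩ ⟨j, hj⟩ (rfl : i + 1 = j)
    have hstep := h i (by simpa using hj)
    simp only [List.getElem_ofFn, IsStep] at hstep
    exact ⟨fun heven => by simpa [heven] using hstep,
      fun hodd => by simpa [Nat.not_even_iff_odd.2 hodd] using hstep⟩

variable [LinearOrder α]

/-- The length of the alternating sublist selected greedily: the direction wanted next is `up`,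
and the current entry is selected when the step leaving it has that direction. By
`isGreatest_greedyAltLength` no sublist with `AlternatesFrom up` is longer. -/
def greedyAltLength : Bool → List α → ℕ
  | _, [] => 0
  | _, [_] => 1
  | up, a :: b :: l =>
    if IsStep up a b then greedyAltLength (!up) (b :: l) + 1 else greedyAltLength up (b :: l)

theorem AlternatesFrom.replace_head {up : Bool} {a b : α} {s : List α}
    (h : AlternatesFrom up (a :: s)) (hab : ¬IsStep up a b) : AlternatesFrom up (b :: s) := by
  cases s with
  | nil => trivial
  | cons c s =>
    refine ⟨?_, h.2⟩
    cases up
    · exact lt_of_lt_of_le h.1 (not_lt.1 hab)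
    · exact lt_of_le_of_lt (not_lt.1 hab) h.1

theorem AlternatesFrom.length_le_greedyAltLength {up : Bool} {s l : List α}
    (h : AlternatesFrom up s) (hs : s.Sublist l) : s.length ≤ greedyAltLength up l := by
  induction l generalizing up s with
  | nil => simpa [greedyAltLength] using hs.length_le
  | cons a l ih =>
    cases l with
    | nil => simpa [greedyAltLength] using hs.length_le
    | cons b l =>
      rw [greedyAltLength]
      split_ifs with hstep
      · cases s with
        | nil => simp
        | cons c s => exact Nat.succ_le_succ (ih h.tail hs.tail)
      · rcases List.sublist_cons_iff.1 hs with hs | ⟨r, rfl, hr⟩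
        · exact ih h hs
        · rcases List.sublist_cons_iff.1 hr with hr | ⟨r, rfl, -⟩
          · exact ih (s := b :: r) (h.replace_head hstep) (hr.cons_cons b)
          · exact absurd h.1 hstep

theorem exists_alternatesFrom_length_eq_greedyAltLength (up : Bool) (a : α) (l : List α) :
    ∃ (c : α) (s : List α), (c :: s).Sublist (a :: l) ∧ AlternatesFrom up (c :: s) ∧
      (c :: s).length = greedyAltLength up (a :: l) ∧ ¬IsStep up a c := by
  induction l generalizing up a with
  | nil => exact ⟨a, [], List.Sublist.refl _, trivial, rfl, by simp⟩
  | cons b l ih =>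
    rw [greedyAltLength]
    split_ifs with hstep
    · obtain ⟨c, s, hs, halt, hlen, hbc⟩ := ih (!up) b
      refine ⟨a, c :: s, hs.cons_cons a, ⟨?_, halt⟩, by rw [List.length_cons, hlen], by simp⟩
      cases up
      · exact lt_of_le_of_lt (not_lt.1 hbc) hstep
      · exact lt_of_lt_of_le hstep (not_lt.1 hbc)
    · obtain ⟨c, s, hs, halt, hlen, hbc⟩ := ih up b
      refine ⟨c, s, hs.cons a, halt, hlen, ?_⟩
      cases up
      · exact not_lt.2 ((not_lt.1 hstep).trans (not_lt.1 hbc))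
      · exact not_lt.2 ((not_lt.1 hbc).trans (not_lt.1 hstep))

theorem isGreatest_greedyAltLength (up : Bool) (l : List α) :
    IsGreatest {k | ∃ s : List α, s.Sublist l ∧ AlternatesFrom up s ∧ s.length = k}
      (greedyAltLength up l) := by
  constructor
  · cases l with
    | nil => exact ⟨[], List.Sublist.refl _, trivial, rfl⟩
    | cons a l =>
      obtain ⟨c, s, hs, halt, hlen, -⟩ :=
        exists_alternatesFrom_length_eq_greedyAltLength up a l
      exact ⟨c :: s, hs, halt, hlen⟩
  · rintro k ⟨s, hs, halt, rfl⟩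
    exact halt.length_le_greedyAltLength hs

theorem greedyAltLength_map {β : Type*} [LinearOrder β] {f : α → β} (hf : StrictMono f)
    (up : Bool) (l : List α) : greedyAltLength up (l.map f) = greedyAltLength up l := by
  induction l generalizing up with
  | nil => rfl
  | cons a l ih =>
    cases l with
    | nil => rfl
    | cons b l =>
      simp only [List.map_cons] at ih
      simp only [List.map_cons, greedyAltLength, IsStep, hf.lt_iff_lt, ih]

/-- One insertion for each of the `k` selected entries leaves the length `k` unchanged, one
raises it by `1`, and all others raise it by `2`. -/
theorem sum_greedyAltLength_insertIdx {R : Type*} [CommRing R] (up : Bool) {l : List α}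
    (hl : l.IsChain (· ≠ ·)) {M : α} (hM : ∀ b ∈ l, b < M) (g : ℕ → R) :
    ∑ i ∈ Finset.range (l.length + 1), g (greedyAltLength up (l.insertIdx i M)) =
      greedyAltLength up l * g (greedyAltLength up l) + g (greedyAltLength up l + 1) +
        (l.length - greedyAltLength up l) * g (greedyAltLength up l + 2) := by
  induction l generalizing up g with
  | nil => simp [greedyAltLength]
  | cons a l ih =>
    cases l with
    | nil =>
      have haM : a < M := hM a (by simp)
      cases up <;> simp [Finset.sum_range_succ, greedyAltLength, IsStep, haM, haM.not_gt, add_comm]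
    | cons b l =>
      obtain ⟨hab, hl⟩ := List.isChain_cons_cons.1 hl
      have haM : a < M := hM a (by simp)
      have hbM : b < M := hM b (by simp)
      have ih := fun up (g : ℕ → R) => ih up hl (fun c hc => hM c (by simp [hc])) g
      simp only [List.length_cons, Finset.sum_range_succ' _ (_ + 1), List.insertIdx_zero,
        List.insertIdx_succ_cons] at ih ⊢
      -- When the step from `a` to `b` is selected, the greedy lengths of the lists extending
      -- `a :: b` exceed those of their tails by one, so `ih` is applied to the shift of `g`.
      rcases hab.lt_or_gt with h | h <;> cases up
      · have hsum := ih false g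
        simp only [greedyAltLength, IsStep, Bool.false_eq_true, ↓reduceIte, Bool.not_false,
          Bool.not_true, Nat.cast_add, Nat.cast_one, haM, haM.not_gt, hbM, h, h.not_gt] at hsum ⊢
        linear_combination hsum
      · have hsum := ih false fun k => g (k + 1)
        simp only [greedyAltLength, IsStep, Bool.false_eq_true, ↓reduceIte, Bool.not_false,
          Bool.not_true, Nat.cast_add, Nat.cast_one, haM, haM.not_gt, hbM, h] at hsum ⊢
        linear_combination hsum
      · have hsum := ih true fun k => g (k + 1)
        simp only [greedyAltLength, IsStep, Bool.false_eq_true, ↓reduceIte, Bool.not_false,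
          Nat.cast_add, Nat.cast_one, haM, haM.not_gt, hbM, hbM.not_gt, h, h.not_gt] at hsum ⊢
        linear_combination hsum
      · have hsum := ih true g
        simp only [greedyAltLength, IsStep, Bool.false_eq_true, ↓reduceIte, Bool.not_false,
          Bool.not_true, Nat.cast_add, Nat.cast_one, haM, haM.not_gt, hbM, hbM.not_gt,
          h.not_gt] at hsum ⊢
        linear_combination hsum

end AlternatingLists

section Permutations

theorem sublist_ofFn_iff {α : Type*} {n : ℕ} {s : List α} {f : Fin n → α} :
    s.Sublist (List.ofFn f) ↔
      ∃ p : Fin s.length → Fin n, StrictMono p ∧ s = List.ofFn fun i => f (p i) := by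
  rw [List.sublist_iff_exists_fin_orderEmbedding_get_eq]
  constructor
  · rintro ⟨p, hp⟩
    refine ⟨fun i => Fin.cast List.length_ofFn (p i), fun i j hij => p.strictMono hij, ?_⟩
    refine List.ext_get (by simp) fun i hi _ => ?_
    exact (hp ⟨i, hi⟩).trans (by rw [List.get_ofFn, List.get_ofFn]; rfl)
  · rintro ⟨p, hp, hs⟩
    refine ⟨OrderEmbedding.ofStrictMono (fun i => Fin.cast List.length_ofFn.symm (p i))
      fun i j hij => hp hij, fun i => ?_⟩
    exact (List.getElem_of_eq hs i.2).trans (by rw [List.getElem_ofFn, List.get_ofFn]; rfl)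

theorem altLength_eq_greedyAltLength {n : ℕ} (w : Equiv.Perm (Fin n)) :
    altLength w = greedyAltLength false (List.ofFn w) := by
  refine (altLength_isGreatest w).unique ?_
  suffices h : altSubseqLengths w =
      {k | ∃ s : List (Fin n), s.Sublist (List.ofFn w) ∧ AlternatesFrom false s ∧ s.length = k} from
    h ▸ isGreatest_greedyAltLength false (List.ofFn w)
  ext k
  constructor
  · rintro ⟨p, hp, halt⟩
    refine ⟨List.ofFn fun i => w (p i), ?_, (isAlternating_iff_alternatesFrom _).1 halt,
      List.length_ofFn⟩
    exact sublist_ofFn_iff.2 ⟨fun i => p (Fin.cast List.length_ofFn i), fun i j hij => hp hij,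
      List.ext_get (by simp) fun i hi _ => by simp⟩
  · rintro ⟨s, hs, halt, rfl⟩
    obtain ⟨p, hp, hsp⟩ := sublist_ofFn_iff.1 hs
    refine ⟨p, hp, (isAlternating_iff_alternatesFrom _).2 ?_⟩
    rwa [← hsp]

theorem altLength_le {n : ℕ} (w : Equiv.Perm (Fin n)) : altLength w ≤ n := by
  obtain ⟨p, hp, -⟩ := (altLength_isGreatest w).1
  simpa using Fintype.card_le_of_injective p hp.injective

theorem altLength_eq_iff_isAlternating {n : ℕ} (w : Equiv.Perm (Fin n)) :
    altLength w = n ↔ IsAlternating w := by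
  constructor
  · intro h
    obtain ⟨p, hp, halt⟩ : n ∈ altSubseqLengths w := by
      simpa only [h] using (altLength_isGreatest w).1
    simpa only [hp.eq_id, id] using halt
  · exact fun h => (altLength_le w).antisymm
      ((altLength_isGreatest w).2 ⟨id, strictMono_id, h⟩)

theorem ofFn_insertNth {α : Type*} {n : ℕ} (i : Fin (n + 1)) (x : α) (f : Fin n → α) :
    List.ofFn (i.insertNth (α := fun _ => α) x f) = (List.ofFn f).insertIdx i x := by
  refine List.ext_getElem ?_ fun k hk _ => ?_
  · rw [List.length_insertIdx_of_le_length (by simpa using i.is_le)]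
    simp
  rw [List.length_ofFn] at hk
  rw [List.getElem_ofFn, List.getElem_insertIdx]
  split_ifs with hki hki'
  · rw [Fin.insertNth_apply_below (j := ⟨k, hk⟩) hki]
    simp only [eq_rec_constant, List.getElem_ofFn]
    rfl
  · subst hki'
    simp
  · rw [Fin.insertNth_apply_above (j := ⟨k, hk⟩) (by simp only [Fin.lt_def]; omega)]
    simp only [eq_rec_constant, List.getElem_ofFn]
    rfl

/-- The permutation whose word is the word of `w` with a new largest letter inserted at
position `i`. -/
def insertMax {n : ℕ} (i : Fin (n + 1)) (w : Equiv.Perm (Fin n)) : Equiv.Perm (Fin (n + 1)) :=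
  (finSuccEquiv' i).trans (w.optionCongr.trans (finSuccEquiv' (Fin.last n)).symm)

theorem insertMax_self {n : ℕ} (i : Fin (n + 1)) (w : Equiv.Perm (Fin n)) :
    insertMax i w i = Fin.last n := by
  simp [insertMax]

theorem insertMax_succAbove {n : ℕ} (i : Fin (n + 1)) (w : Equiv.Perm (Fin n)) (j : Fin n) :
    insertMax i w (i.succAbove j) = (w j).castSucc := by
  simp [insertMax]

theorem insertMax_bijective (n : ℕ) :
    Function.Bijective fun p : Fin (n + 1) × Equiv.Perm (Fin n) => insertMax p.1 p.2 := by
  rw [Fintype.bijective_iff_injective_and_card]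
  constructor
  · rintro ⟨i, w⟩ ⟨j, v⟩ (h : insertMax i w = insertMax j v)
    obtain rfl : i = j := (insertMax i w).injective <| by
      rw [insertMax_self, h, insertMax_self]
    refine Prod.ext rfl (Equiv.ext fun k => Fin.castSucc_injective n ?_)
    rw [← insertMax_succAbove i, h, insertMax_succAbove]
  · simp [Fintype.card_perm, Nat.factorial_succ]

theorem ofFn_insertMax {n : ℕ} (i : Fin (n + 1)) (w : Equiv.Perm (Fin n)) :
    List.ofFn (insertMax i w) = ((List.ofFn w).map Fin.castSucc).insertIdx i (Fin.last n) := by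
  have h : ⇑(insertMax i w) =
      i.insertNth (α := fun _ => Fin (n + 1)) (Fin.last n) (Fin.castSucc ∘ w) :=
    Fin.eq_insertNth_iff.2 ⟨insertMax_self i w, funext (insertMax_succAbove i w)⟩
  rw [h, ofFn_insertNth, List.map_ofFn]

theorem sum_altLength_insertMax {R : Type*} [CommRing R] {n : ℕ} (w : Equiv.Perm (Fin n))
    (g : ℕ → R) :
    ∑ i, g (altLength (insertMax i w)) =
      altLength w * g (altLength w) + g (altLength w + 1) +
        (n - altLength w) * g (altLength w + 2) := by
  have hw : ((List.ofFn w).map Fin.castSucc).Nodup :=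
    (List.nodup_ofFn.2 w.injective).map (Fin.castSucc_injective n)
  have h := sum_greedyAltLength_insertIdx false (List.Pairwise.isChain hw)
    (M := Fin.last n) (by simp [Fin.castSucc_lt_last]) g
  rw [greedyAltLength_map Fin.strictMono_castSucc, ← altLength_eq_greedyAltLength,
    List.length_map, List.length_ofFn, Finset.sum_range] at h
  simpa only [altLength_eq_greedyAltLength (insertMax _ w), ofFn_insertMax] using h

theorem sum_perm_succ_altLength {R : Type*} [CommRing R] (n : ℕ) (g : ℕ → R) :
    ∑ v : Equiv.Perm (Fin (n + 1)), g (altLength v) =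
      ∑ w : Equiv.Perm (Fin n), (altLength w * g (altLength w) + g (altLength w + 1) +
        (n - altLength w) * g (altLength w + 2)) := by
  rw [← (insertMax_bijective n).sum_comp, Fintype.sum_prod_type_right]
  simp only [sum_altLength_insertMax]

end Permutations

section Grammar

variable {R A : Type*} [CommRing R] [CommRing A] [Algebra R A]

/-- The homogenization `∑_w x ^ as(w) * y ^ (n - as(w))` of `T_n`, where `w` ranges over the
permutations of `n` letters. No subtraction is truncated, by `altLength_le`. -/
noncomputable def altForm (x y : A) (n : ℕ) : A :=
  ∑ w : Equiv.Perm (Fin n), x ^ altLength w * y ^ (n - altLength w)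

theorem map_altForm {B F : Type*} [CommRing B] [FunLike F A B] [RingHomClass F A B] (f : F)
    (x y : A) (n : ℕ) : f (altForm x y n) = altForm (f x) (f y) n := by
  simp only [altForm, map_sum, map_mul, map_pow]

theorem altForm_one_zero (n : ℕ) : altForm (1 : A) 0 n = eulerNumber n := by
  have hterm (w : Equiv.Perm (Fin n)) :
      (1 : A) ^ altLength w * 0 ^ (n - altLength w) = if IsAlternating w then 1 else 0 := by
    have : n - altLength w = 0 ↔ IsAlternating w := by
      rw [← altLength_eq_iff_isAlternating, Nat.sub_eq_zero_iff_le]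
      exact ⟨(altLength_le w).antisymm, Eq.ge⟩
    simp only [one_pow, one_mul, zero_pow_eq, this]
  simp only [altForm, hterm, Finset.sum_boole, eulerNumber]

theorem altPoly_eq_altForm (n : ℕ) : altPoly n = altForm X 1 n := by
  have hmaps : ∀ w ∈ (Finset.univ : Finset (Equiv.Perm (Fin n))),
      altLength w ∈ Finset.range (n + 1) :=
    fun w _ => Finset.mem_range_succ_iff.2 (altLength_le w)
  simp only [altPoly, altForm, altCount, one_pow, mul_one]
  rw [← Finset.sum_fiberwise_of_maps_to hmaps]
  refine Finset.sum_congr rfl fun k _ => ?_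
  rw [Finset.sum_congr rfl fun w hw => by rw [(Finset.mem_filter.1 hw).2], Finset.sum_const,
    nsmul_eq_mul, map_natCast]

theorem derivation_pow_mul_pow (D : Derivation R A A) {x y : A} (hx : D x = x * y)
    (hy : D y = x ^ 2) (a b : ℕ) :
    D (x ^ a * y ^ b) = a * (x ^ a * y ^ (b + 1)) + b * (x ^ (a + 2) * y ^ (b - 1)) := by
  rw [D.leibniz, D.leibniz_pow, D.leibniz_pow, hx, hy]
  simp only [smul_eq_mul, nsmul_eq_mul]
  rcases a with _ | a
  · rw [Nat.cast_zero]
    ring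
  · rw [Nat.add_sub_cancel]
    ring

theorem altForm_succ (D : Derivation R A A) {x y : A} (hx : D x = x * y) (hy : D y = x ^ 2)
    (n : ℕ) : altForm x y (n + 1) = D (altForm x y n) + x * altForm x y n := by
  simp only [altForm]
  rw [sum_perm_succ_altLength n fun k => x ^ k * y ^ (n + 1 - k), map_sum, Finset.mul_sum,
    ← Finset.sum_add_distrib]
  refine Finset.sum_congr rfl fun w _ => ?_
  have hle := altLength_le w
  rw [derivation_pow_mul_pow D hx hy, Nat.cast_sub hle, Nat.sub_add_comm hle,
    Nat.add_sub_add_right, show n + 1 - (altLength w + 2) = n - altLength w - 1 by omega]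
  ring

theorem add_mul_altForm (D : Derivation R A A) {x y : A} (hx : D x = x * y) (hy : D y = x ^ 2)
    (n : ℕ) : (x + y) * altForm x y n = D^[n] (x + y) := by
  induction n with
  | zero => simp [altForm, Nat.le_zero.1 (altLength_le (1 : Equiv.Perm (Fin 0)))]
  | succ n ih =>
    rw [Function.iterate_succ_apply', ← ih, D.leibniz, map_add, hx, hy, altForm_succ D hx hy]
    simp only [smul_eq_mul]
    ring

theorem iterate_smul_derivation (k : R) (D : Derivation R A A) (n : ℕ) (a : A) :
    (k • D)^[n] a = k ^ n • D^[n] a := by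
  induction n with
  | zero => simp
  | succ n ih =>
    rw [Function.iterate_succ_apply', ih, Function.iterate_succ_apply', Derivation.smul_apply,
      D.map_smul, smul_smul, pow_succ']

/-- The coefficients in `D^[n] z = ∑ l, tangentTriangle n l * z ^ (n + 1 - 2 * l) * c ^ l` for a
solution `z` of the Riccati equation `D z = z ^ 2 + c` with constant `c`; for `c = 1` these are the
derivative polynomials of the tangent. -/
def tangentTriangle : ℕ → ℕ → ℕ
  | 0, 0 => 1
  | 0, _ + 1 => 0
  | n + 1, 0 => (n + 1) * tangentTriangle n 0
  | n + 1, l + 1 =>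
    (n - 1 - 2 * l) * tangentTriangle n (l + 1) + (n + 1 - 2 * l) * tangentTriangle n l

theorem tangentTriangle_eq_zero {n l : ℕ} (h : n + 1 < 2 * l) : tangentTriangle n l = 0 := by
  induction n generalizing l with
  | zero =>
    obtain ⟨l, rfl⟩ : ∃ k, l = k + 1 := ⟨l - 1, by omega⟩
    rfl
  | succ n ih =>
    obtain ⟨l, rfl⟩ : ∃ k, l = k + 1 := ⟨l - 1, by omega⟩
    rw [tangentTriangle, ih (by omega), show n + 1 - 2 * l = 0 by omega, mul_zero, zero_mul,
      add_zero]

theorem tangentTriangle_odd_eq_even (m : ℕ) :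
    tangentTriangle (2 * m + 1) (m + 1) = tangentTriangle (2 * m) m := by
  rw [tangentTriangle, show 2 * m - 1 - 2 * m = 0 by omega, Nat.add_sub_cancel_left, zero_mul,
    zero_add, one_mul]

theorem derivation_pow_mul_pow_of_riccati (D : Derivation R A A) {z c : A}
    (hz : D z = z ^ 2 + c) (hc : D c = 0) (m l : ℕ) :
    D (z ^ m * c ^ l) = m * (z ^ (m + 1) * c ^ l) + m * (z ^ (m - 1) * c ^ (l + 1)) := by
  rw [D.leibniz, D.leibniz_pow, D.leibniz_pow, hz, hc]
  simp only [smul_eq_mul, nsmul_eq_mul]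
  rcases m with _ | m
  · simp
  · rw [Nat.add_sub_cancel]
    ring

theorem iterate_derivation_of_riccati (D : Derivation R A A) {z c : A} (hz : D z = z ^ 2 + c)
    (hc : D c = 0) (n : ℕ) :
    D^[n] z =
      ∑ l ∈ Finset.range (n + 1), tangentTriangle n l * (z ^ (n + 1 - 2 * l) * c ^ l) := by
  induction n with
  | zero => simp [tangentTriangle]
  | succ n ih =>
    let raise (l : ℕ) : A :=
      (n + 1 - 2 * l : ℕ) * tangentTriangle n l * (z ^ (n + 2 - 2 * l) * c ^ l)
    let lower (l : ℕ) : A :=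
      (n + 1 - 2 * l : ℕ) * tangentTriangle n l * (z ^ (n - 2 * l) * c ^ (l + 1))
    have hterm (l : ℕ) : D (tangentTriangle n l * (z ^ (n + 1 - 2 * l) * c ^ l)) =
        raise l + lower l := by
      rw [← nsmul_eq_mul, map_nsmul, derivation_pow_mul_pow_of_riccati D hz hc, nsmul_eq_mul]
      rcases Nat.lt_or_ge (n + 1) (2 * l) with h | h
      · simp [raise, lower, tangentTriangle_eq_zero h]
      · simp only [raise, lower, show n + 1 - 2 * l + 1 = n + 2 - 2 * l by omega,
          show n + 1 - 2 * l - 1 = n - 2 * l by omega]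
        ring
    have hshift : ∑ l ∈ Finset.range (n + 1), raise l =
        ∑ l ∈ Finset.range (n + 1), raise (l + 1) + raise 0 := by
      have hlast : raise (n + 1) = 0 := by
        simp only [raise, show n + 1 - 2 * (n + 1) = 0 by omega, Nat.cast_zero, zero_mul]
      rw [← Finset.sum_range_succ', Finset.sum_range_succ _ (n + 1), hlast, add_zero]
    rw [Function.iterate_succ_apply', ih, map_sum, Finset.sum_congr rfl fun l _ => hterm l,
      Finset.sum_add_distrib, hshift, Finset.sum_range_succ' _ (n + 1), add_right_comm,
      ← Finset.sum_add_distrib]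
    refine congrArg₂ _ (Finset.sum_congr rfl fun l _ => ?_) ?_
    · simp only [raise, lower, tangentTriangle, show n + 2 - 2 * (l + 1) = n - 2 * l by omega,
        show n + 1 - 2 * (l + 1) = n - 1 - 2 * l by omega]
      push_cast
      ring
    · simp [raise, tangentTriangle]

theorem derivation_sq_sub_sq (D : Derivation R A A) {x y : A} (hx : D x = x * y)
    (hy : D y = x ^ 2) : D (x ^ 2 - y ^ 2) = 0 := by
  rw [map_sub, D.leibniz_pow, D.leibniz_pow, hx, hy]
  simp only [smul_eq_mul, nsmul_eq_mul]
  ring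

theorem two_pow_mul_add_mul_altForm (D : Derivation R A A) {x y : A} (hx : D x = x * y)
    (hy : D y = x ^ 2) (n : ℕ) :
    2 ^ n * ((x + y) * altForm x y n) = ∑ l ∈ Finset.range (n + 1),
      tangentTriangle n l * ((x + y) ^ (n + 1 - 2 * l) * (x ^ 2 - y ^ 2) ^ l) := by
  have hz : ((2 : R) • D) (x + y) = (x + y) ^ 2 + (x ^ 2 - y ^ 2) := by
    rw [Derivation.smul_apply, map_add, hx, hy, ofNat_smul_eq_nsmul, nsmul_eq_mul]
    push_cast
    ring
  have hc : ((2 : R) • D) (x ^ 2 - y ^ 2) = 0 := by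
    rw [Derivation.smul_apply, derivation_sq_sub_sq D hx hy, smul_zero]
  rw [← iterate_derivation_of_riccati _ hz hc, iterate_smul_derivation, add_mul_altForm D hx hy,
    Algebra.smul_def, map_pow, map_ofNat]

theorem add_mul_altForm_add_sub_mul_altForm_neg (D : Derivation R A A) {x y : A}
    (hx : D x = x * y) (hy : D y = x ^ 2) {n : ℕ} (hn : Odd n) :
    (x + y) * altForm x y n + (x - y) * altForm x (-y) n = 2 * ∑ l ∈ Finset.range (n + 1),
      tangentTriangle n l * (y ^ (n + 1 - 2 * l) * (x ^ 2 - y ^ 2) ^ l) := by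
  have hx' : ((-1 : R) • D) x = x * -y := by simp [hx]
  have hy' : ((-1 : R) • D) (-y) = x ^ 2 := by simp [hy]
  have hneg : (x - y) * altForm x (-y) n = D^[n] y - D^[n] x := by
    rw [sub_eq_add_neg, add_mul_altForm _ hx' hy', iterate_smul_derivation, hn.neg_one_pow,
      iterate_map_add, iterate_map_neg]
    simp only [neg_smul, one_smul]
    ring
  have hz : D y = y ^ 2 + (x ^ 2 - y ^ 2) := by rw [hy]; ring
  rw [hneg, add_mul_altForm D hx hy, iterate_map_add,
    ← iterate_derivation_of_riccati D hz (derivation_sq_sub_sq D hx hy)]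
  ring

/-- The derivation of `ℤ[x, y]` for which `x` and `y` behave like the secant and the tangent. It
carries the identities for `altForm` over to arbitrary elements of commutative rings. -/
noncomputable def secTanDerivation :
    Derivation ℤ (MvPolynomial (Fin 2) ℤ) (MvPolynomial (Fin 2) ℤ) :=
  MvPolynomial.mkDerivation ℤ
    ![MvPolynomial.X 0 * MvPolynomial.X 1, MvPolynomial.X 0 ^ 2]

theorem secTanDerivation_X_zero :
    secTanDerivation (MvPolynomial.X 0) = MvPolynomial.X 0 * MvPolynomial.X 1 := by
  simp [secTanDerivation, MvPolynomial.mkDerivation_X]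

theorem secTanDerivation_X_one :
    secTanDerivation (MvPolynomial.X 1) = MvPolynomial.X 0 ^ 2 := by
  simp [secTanDerivation, MvPolynomial.mkDerivation_X]

theorem two_pow_mul_altForm (x y : A) (n : ℕ) :
    2 ^ n * altForm x y n = (x + y) ^ (n / 2) * ∑ l ∈ Finset.range (n + 1),
      tangentTriangle n l * ((x + y) ^ ((n + 1) / 2 - l) * (x - y) ^ l) := by
  let P := MvPolynomial (Fin 2) ℤ
  let u : P := MvPolynomial.X 0
  let v : P := MvPolynomial.X 1
  have huv : u + v ≠ 0 := by
    intro h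
    simpa [u, v] using congrArg (MvPolynomial.eval ![1, 0]) h
  have huniv : 2 ^ n * altForm u v n = (u + v) ^ (n / 2) * ∑ l ∈ Finset.range (n + 1),
      tangentTriangle n l * ((u + v) ^ ((n + 1) / 2 - l) * (u - v) ^ l) := by
    refine mul_left_cancel₀ huv ?_
    rw [mul_left_comm, two_pow_mul_add_mul_altForm secTanDerivation secTanDerivation_X_zero
      secTanDerivation_X_one, ← mul_assoc, Finset.mul_sum]
    refine Finset.sum_congr rfl fun l _ => ?_
    rcases Nat.lt_or_ge (n + 1) (2 * l) with h | h
    · simp [tangentTriangle_eq_zero h]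
    · have hexp : n + 1 - 2 * l + l = 1 + n / 2 + ((n + 1) / 2 - l) := by omega
      have := congrArg ((u + v) ^ ·) hexp
      simp only [pow_add, pow_one] at this
      rw [sq_sub_sq, mul_pow]
      linear_combination tangentTriangle n l * (u - v) ^ l * this
  simpa [map_altForm, u, v] using congrArg (MvPolynomial.aeval ![x, y]) huniv

theorem eulerNumber_odd (m : ℕ) :
    eulerNumber (2 * m + 1) = tangentTriangle (2 * m + 1) (m + 1) := by
  have hsum : ∑ l ∈ Finset.range (2 * m + 1 + 1),
      (tangentTriangle (2 * m + 1) l : ℤ) * 0 ^ (2 * m + 1 + 1 - 2 * l) =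
        tangentTriangle (2 * m + 1) (m + 1) := by
    rw [Finset.sum_eq_single (m + 1)]
    · simp [mul_add]
    · intro l _ hl
      rcases Nat.lt_or_gt_of_ne hl with h | h
      · rw [zero_pow (by omega), mul_zero]
      · rw [tangentTriangle_eq_zero (by omega), Nat.cast_zero, zero_mul]
    · intro h
      exact absurd (Finset.mem_range.2 (by omega)) h
  have hdouble : (eulerNumber (2 * m + 1) + eulerNumber (2 * m + 1) : ℤ) =
      2 * tangentTriangle (2 * m + 1) (m + 1) := by
    simpa [map_altForm, altForm_one_zero, hsum] using congrArg (MvPolynomial.eval ![1, 0]) <|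
      add_mul_altForm_add_sub_mul_altForm_neg secTanDerivation secTanDerivation_X_zero
        secTanDerivation_X_one (odd_two_mul_add_one m)
  omega

end Grammar

section Quotient

theorem dvd_of_monic_of_dvd_C_mul {R : Type*} [CommRing R] [NoZeroDivisors R] {p q : R[X]} {a : R}
    (hp : p.Monic) (ha : a ≠ 0) (h : p ∣ C a * q) : p ∣ q := by
  rw [← modByMonic_eq_zero_iff_dvd hp, ← smul_eq_C_mul, smul_modByMonic] at h
  rw [← modByMonic_eq_zero_iff_dvd hp]
  exact (smul_eq_zero.1 h).resolve_left ha

theorem two_pow_mul_altPoly (n : ℕ) :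
    2 ^ n * altPoly n = (1 + X) ^ (n / 2) * ∑ l ∈ Finset.range (n + 1),
      (tangentTriangle n l : ℤ[X]) * ((1 + X) ^ ((n + 1) / 2 - l) * (X - 1) ^ l) := by
  simpa only [altPoly_eq_altForm, add_comm X] using two_pow_mul_altForm (X : ℤ[X]) 1 n

theorem monic_one_add_X_pow (k : ℕ) : ((1 + X : ℤ[X]) ^ k).Monic := by
  rw [add_comm]
  exact (monic_X_add_C 1).pow k

theorem one_add_X_pow_dvd_altPoly (n : ℕ) : (1 + X : ℤ[X]) ^ (n / 2) ∣ altPoly n := by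
  refine dvd_of_monic_of_dvd_C_mul (a := 2 ^ n) (monic_one_add_X_pow _) (by positivity) ?_
  rw [C_pow, C_ofNat, two_pow_mul_altPoly]
  exact dvd_mul_right _ _

theorem two_pow_mul_eval_neg_one_of_altPoly_eq {n : ℕ} {U : ℤ[X]}
    (hU : altPoly n = (1 + X) ^ (n / 2) * U) :
    2 ^ n * U.eval (-1) = tangentTriangle n ((n + 1) / 2) * (-2) ^ ((n + 1) / 2) := by
  have hquot : 2 ^ n * U = ∑ l ∈ Finset.range (n + 1),
      (tangentTriangle n l : ℤ[X]) * ((1 + X) ^ ((n + 1) / 2 - l) * (X - 1) ^ l) := by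
    refine mul_left_cancel₀ (monic_one_add_X_pow (n / 2)).ne_zero ?_
    rw [mul_left_comm, ← hU, two_pow_mul_altPoly]
  have h := congrArg (eval (-1)) hquot
  rw [eval_finsetSum, Finset.sum_eq_single ((n + 1) / 2)] at h
  · simpa using h
  · intro l _ hl
    rcases Nat.lt_or_gt_of_ne hl with hl | hl
    · simp [Nat.sub_ne_zero_of_lt hl]
    · simp [tangentTriangle_eq_zero (show n + 1 < 2 * l by omega)]
  · intro h
    exact absurd (Finset.mem_range.2 (by omega)) h

theorem altPoly_eval_neg_one {n : ℕ} (hn : 2 ≤ n) : (altPoly n).eval (-1) = 0 := by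
  obtain ⟨U, hU⟩ := one_add_X_pow_dvd_altPoly n
  have hhalf : n / 2 ≠ 0 := by omega
  simp [hU, hhalf]

theorem card_even_altLength_eq_card_odd_altLength {n : ℕ} (hn : 2 ≤ n) :
    (Finset.univ.filter fun w : Equiv.Perm (Fin n) => Even (altLength w)).card =
      (Finset.univ.filter fun w : Equiv.Perm (Fin n) => Odd (altLength w)).card := by
  have hsum : ∑ w : Equiv.Perm (Fin n), (-1 : ℤ) ^ altLength w = 0 := by
    rw [← altPoly_eval_neg_one hn, altPoly_eq_altForm, ← coe_evalRingHom, map_altForm]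
    simp [altForm]
  have hsign (k : ℕ) : (-1 : ℤ) ^ k = (if Even k then 1 else 0) - (if Odd k then 1 else 0) := by
    rcases Nat.even_or_odd k with h | h
    · simp [h.neg_one_pow, h, Nat.not_odd_iff_even.2 h]
    · simp [h.neg_one_pow, h, Nat.not_even_iff_odd.2 h]
  simp only [hsign, Finset.sum_sub_distrib, Finset.sum_boole, sub_eq_zero] at hsum
  exact_mod_cast hsum

theorem card_even_altLength {n : ℕ} (hn : 2 ≤ n) :
    ((Finset.univ.filter fun w : Equiv.Perm (Fin n) => Even (altLength w)).card : ℚ) =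
      (n.factorial : ℚ) / 2 := by
  have htotal := Finset.card_filter_add_card_filter_not
    (s := (Finset.univ : Finset (Equiv.Perm (Fin n)))) fun w => Even (altLength w)
  simp only [Nat.not_even_iff_odd, Finset.card_univ, Fintype.card_perm, Fintype.card_fin,
    ← card_even_altLength_eq_card_odd_altLength hn] at htotal
  rw [← htotal, Nat.cast_add, add_self_div_two]

theorem eval_neg_one_of_altPoly_even_eq {n : ℕ} {U : ℤ[X]}
    (hU : altPoly (2 * n) = (1 + X) ^ (2 * n / 2) * U) :
    ((U.eval (-1) : ℤ) : ℚ) = (-1) ^ n * (eulerNumber (2 * n + 1) : ℚ) / 2 ^ n := by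
  have h := two_pow_mul_eval_neg_one_of_altPoly_eq hU
  rw [show (2 * n + 1) / 2 = n by omega, ← tangentTriangle_odd_eq_even, ← eulerNumber_odd,
    neg_pow] at h
  qify at h
  rw [eq_div_iff (by positivity)]
  refine mul_left_cancel₀ (pow_ne_zero n (two_ne_zero (α := ℚ))) ?_
  linear_combination h

theorem neg_eval_neg_one_of_altPoly_odd_eq {n : ℕ} {U : ℤ[X]}
    (hU : altPoly (2 * n + 1) = (1 + X) ^ ((2 * n + 1) / 2) * U) :
    -((U.eval (-1) : ℤ) : ℚ) = (-1) ^ n * (eulerNumber (2 * n + 1) : ℚ) / 2 ^ n := by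
  have h := two_pow_mul_eval_neg_one_of_altPoly_eq hU
  rw [show (2 * n + 1 + 1) / 2 = n + 1 by omega, ← eulerNumber_odd, neg_pow] at h
  qify at h
  rw [eq_div_iff (by positivity)]
  refine mul_left_cancel₀ (pow_ne_zero n (two_ne_zero (α := ℚ))) ?_
  linear_combination -h / 2

end Quotient

theorem mainTheorem5 :
    (∀ n : ℕ, (1 + X : ℤ[X]) ^ (n / 2) ∣ altPoly n) ∧
    (∀ U : ℕ → ℤ[X], (∀ n : ℕ, altPoly n = (1 + X) ^ (n / 2) * U n) →
      ∀ n : ℕ,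
        (((U (2 * n)).eval (-1) : ℤ) : ℚ) = (-1) ^ n * (eulerNumber (2 * n + 1) : ℚ) / 2 ^ n ∧
        -(((U (2 * n + 1)).eval (-1) : ℤ) : ℚ) =
          (-1) ^ n * (eulerNumber (2 * n + 1) : ℚ) / 2 ^ n) ∧
    (∀ n : ℕ, 2 ≤ n →
      (altPoly n).eval (-1) = 0 ∧
      ((Finset.univ.filter fun w : Equiv.Perm (Fin n) => Even (altLength w)).card : ℚ) =
        (Nat.factorial n : ℚ) / 2 ∧
      ((Finset.univ.filter fun w : Equiv.Perm (Fin n) => Odd (altLength w)).card : ℚ) =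
        (Nat.factorial n : ℚ) / 2) := by
  refine ⟨one_add_X_pow_dvd_altPoly, fun U hU n => ?_, fun n hn => ?_⟩
  · exact ⟨eval_neg_one_of_altPoly_even_eq (hU _), neg_eval_neg_one_of_altPoly_odd_eq (hU _)⟩
  · refine ⟨altPoly_eval_neg_one hn, card_even_altLength hn, ?_⟩
    rw [← card_even_altLength_eq_card_odd_altLength hn]
    exact card_even_altLength hn
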